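/- Let $a<b$ be real numbers, let $\tilde\Omega=\mathbb R\setminus(a,b)$, and let $H^{1/2}_{\tilde\Omega}$ be the space of measurable functions $u:\mathbb R\to\mathbb R$ such that $$\|u\|_{H^{1/2}_{\tilde\Omega}}^2=\frac1{2\pi}\iint_{\mathbb R^2\setminus(a,b)^2}\frac{|u(x)-u(y)|^2}{|x-y|^2}\,dy\,dx+\int_{\mathbb R\setminus(a,b)}|u|^2\,dx<\infty .$$ For $y\in\mathbb R$ and $\kappa>0$ put $\Lambda(y,\kappa)=(y-\kappa,y+\kappa)\cap(\mathbb R\setminus(a,b))$. Let $(u_n)$ be a sequence in $H^{1/2}_{\tilde\Omega}$ that is bounded, i.e. $\sup_n\|u_n\|_{H^{1/2}_{\tilde\Omega}}<\infty$, and suppose that for some $\kappa>0$ $$\lim_{n\to\infty}\ \sup_{y\in\mathbb R,\ \Lambda(y,\kappa)\ne\emptyset}\ \int_{\Lambda(y,\kappa)}|u_n|^2\,dx=0 .$$ Then, for every $p\in(2,\infty)$, every $u_n$ belongs to $L^p(\mathbb R\setminus(a,b))$ and $$\lim_{n\to\infty}\int_{\mathbb R\setminus(a,b)}|u_n|^p\,dx=0,$$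 that is, $u_n\to0$ in $L^p(\mathbb R\setminus(a,b))$. -/

import Mathlib

open MeasureTheory Filter Topology Set
open scoped ENNReal

noncomputable section

/-- The exterior domain `ℝ \ (a, b)`. -/
def extDomain (a b : ℝ) : Set ℝ := (Ioo a b)ᶜ

/-- The squared norm `(1/2π) ∬_{ℝ² \ (a,b)²} |u(x) - u(y)|² / |x - y|² dy dx + ∫_{ℝ \ (a,b)} |u|² dx`,
as an extended nonnegative real. -/
def extEnergy (a b : ℝ) (u : ℝ → ℝ) : ℝ≥0∞ :=
  ENNReal.ofReal (1 / (2 * Real.pi)) *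
      (∫⁻ z in (Ioo a b ×ˢ Ioo a b : Set (ℝ × ℝ))ᶜ,
        ENNReal.ofReal (|u z.1 - u z.2| ^ 2 / |z.1 - z.2| ^ 2))
    + ∫⁻ x in extDomain a b, ENNReal.ofReal (|u x| ^ 2)

/-- The fractional Sobolev space: Lebesgue measurable functions `ℝ → ℝ` of finite energy.
For the Lebesgue measure, `AEMeasurable` is Lebesgue measurability. -/
def HHalfExt (a b : ℝ) : Set (ℝ → ℝ) :=
  {u | AEMeasurable u volume ∧ extEnergy a b u < ∞}

/-- The norm of the fractional Sobolev space. -/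
def hHalfExtNorm (a b : ℝ) (u : ℝ → ℝ) : ℝ := Real.sqrt (extEnergy a b u).toReal

/-- `Λ(y, κ) = (y - κ, y + κ) ∩ (ℝ \ (a, b))`. -/
def extInterval (a b y κ : ℝ) : Set ℝ := Ioo (y - κ) (y + κ) ∩ extDomain a b

end

/-! A large value |u(x)| forces large difference quotients. If ∫_I |u|^s ≤ N on a one-sided interval
I at x of length r ~ N/|u(x)|^s, then |u| < |u(x)|/2 on half of I, so ∫_I |u(x)-u(y)|²/|x-y|² dy ≳
|u(x)|²/r ~ |u(x)|^(s+2)/N (`pow_le_lintegral_diffQuot`). Integration in x gains two powers of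
integrability, with a factor N. For s = 2 and r ≤ κ only the local mass enters, while r > κ means
|u(x)|² ≲ N/κ; hence vanishing local mass kills the L⁴ norm (`extPow_four_le`). Iteration reaches
all even powers, and interpolation with L² gives every p > 2. -/

/-- The fractional difference quotient of order `1/2`, squared. -/
noncomputable def diffQuot (u : ℝ → ℝ) (x y : ℝ) : ℝ≥0∞ :=
  ENNReal.ofReal (|u x - u y| ^ 2 / |x - y| ^ 2)

/-- The part of the energy carried by the product of the exterior domain with itself. -/
noncomputable def extSeminorm (a b : ℝ) (u : ℝ → ℝ) : ℝ≥0∞ :=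
  ∫⁻ x in extDomain a b, ∫⁻ y in extDomain a b, diffQuot u x y

/-- The integral of the `m`-th power over the exterior domain. -/
noncomputable def extPow (a b : ℝ) (u : ℝ → ℝ) (m : ℕ) : ℝ≥0∞ :=
  ∫⁻ x in extDomain a b, ENNReal.ofReal (|u x| ^ m)

theorem measurableSet_extDomain (a b : ℝ) : MeasurableSet (extDomain a b) :=
  measurableSet_Ioo.compl

/-! ### Pointwise lower bound for the difference quotients -/

/-- If `u` is small in mean on a set `I` near `x`, then `u` differs from `u x` on half of `I`,
which bounds `|u x|` by the difference quotients. -/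
theorem pow_le_lintegral_diffQuot {u : ℝ → ℝ} (hu : AEMeasurable u volume) {x N r : ℝ} {s : ℕ}
    (hx : 0 < |u x|) (hN : 0 < N) (hr : r = 2 ^ (s + 1) * N / |u x| ^ s) {I : Set ℝ}
    (hI : MeasurableSet I) (hvol : volume I = ENNReal.ofReal r)
    (hdist : ∀ y ∈ I, |x - y| ≤ r)
    (hint : ∫⁻ y in I, ENNReal.ofReal (|u y| ^ s) ≤ ENNReal.ofReal N) :
    ENNReal.ofReal (|u x| ^ (s + 2)) ≤
      ENNReal.ofReal (2 ^ (s + 4) * N) * ∫⁻ y in I, diffQuot u x y := by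
  set l := |u x|
  have hr0 : 0 < r := by rw [hr]; positivity
  set μ := volume.restrict I with hμ
  have huI : AEMeasurable u μ := hu.mono_measure Measure.restrict_le_self
  have hus : AEMeasurable (fun y => ENNReal.ofReal (|u y| ^ s)) μ := by fun_prop
  have hF : AEMeasurable (fun y => diffQuot u x y) μ := by
    unfold diffQuot; fun_prop
  -- Chebyshev: r is chosen so that |u| ≥ l/2 on at most half of I.
  set B : Set ℝ := {y | ENNReal.ofReal ((l / 2) ^ s) ≤ ENNReal.ofReal (|u y| ^ s)} with hB
  have hc : 0 < (l / 2) ^ s := by positivity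
  have hBm : μ B ≤ ENNReal.ofReal (r / 2) := by
    have h1 := (mul_meas_ge_le_lintegral₀ hus (ENNReal.ofReal ((l / 2) ^ s))).trans hint
    have h2 : ENNReal.ofReal N = ENNReal.ofReal ((l / 2) ^ s) * ENNReal.ofReal (r / 2) := by
      rw [← ENNReal.ofReal_mul hc.le, hr]
      congr 1
      rw [div_pow]
      field_simp
      ring
    rw [h2] at h1
    exact (ENNReal.mul_le_mul_iff_right (by simpa using hc) ENNReal.ofReal_ne_top).1 h1
  have hBc : ENNReal.ofReal (r / 2) ≤ μ Bᶜ := by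
    have h1 : μ univ ≤ μ B + μ Bᶜ := by
      rw [← union_compl_self B]; exact measure_union_le _ _
    have h2 : μ univ = ENNReal.ofReal (r / 2) + ENNReal.ofReal (r / 2) := by
      rw [hμ, Measure.restrict_apply_univ, hvol,
        ← ENNReal.ofReal_add (by positivity) (by positivity)]
      congr 1; ring
    rw [h2] at h1
    exact (ENNReal.add_le_add_iff_left ENNReal.ofReal_ne_top).1
      (h1.trans (add_le_add hBm le_rfl))
  set C : Set ℝ := {y | ENNReal.ofReal (l ^ 2 / (4 * r ^ 2)) ≤ diffQuot u x y} with hC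
  have hBC : μ Bᶜ ≤ μ C := by
    refine measure_mono_ae ?_
    filter_upwards [ae_restrict_mem hI] with y hy hyB
    have h1 : |u y| ^ s < (l / 2) ^ s := by
      have h : ¬ (ENNReal.ofReal ((l / 2) ^ s) ≤ ENNReal.ofReal (|u y| ^ s)) := hyB
      rw [ENNReal.ofReal_le_ofReal_iff (by positivity)] at h
      exact not_le.1 h
    have h2 : |u y| < l / 2 := lt_of_pow_lt_pow_left₀ s (by positivity) h1
    have h3 : l / 2 ≤ |u x - u y| := by
      have := abs_sub_abs_le_abs_sub (u x) (u y)
      linarith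
    -- Needed since division by zero gives 0, so the quotient vanishes at y = x.
    have h4 : 0 < |x - y| := by
      rw [abs_pos, sub_ne_zero]
      rintro rfl
      simp at h3; linarith
    change ENNReal.ofReal _ ≤ ENNReal.ofReal _
    refine ENNReal.ofReal_le_ofReal ?_
    have h5 : l ^ 2 / (4 * r ^ 2) = (l / 2) ^ 2 / r ^ 2 := by field_simp; ring
    rw [h5]
    have := hdist y hy
    gcongr
  have hmain : ENNReal.ofReal (l ^ 2 / (8 * r)) ≤ ∫⁻ y in I, diffQuot u x y := by
    calc ENNReal.ofReal (l ^ 2 / (8 * r))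
        = ENNReal.ofReal (l ^ 2 / (4 * r ^ 2)) * ENNReal.ofReal (r / 2) := by
          rw [← ENNReal.ofReal_mul (by positivity)]
          congr 1; field_simp; ring
      _ ≤ ENNReal.ofReal (l ^ 2 / (4 * r ^ 2)) * μ C := by gcongr; exact hBc.trans hBC
      _ ≤ _ := mul_meas_ge_le_lintegral₀ hF _
  calc ENNReal.ofReal (l ^ (s + 2))
      = ENNReal.ofReal (2 ^ (s + 4) * N) * ENNReal.ofReal (l ^ 2 / (8 * r)) := by
        rw [← ENNReal.ofReal_mul (by positivity), hr]
        congr 1; field_simp; ring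
    _ ≤ _ := by gcongr

/-- From a point of the exterior domain one can move by any length in one direction. -/
theorem exists_subset_extDomain {a b x : ℝ} (hx : x ∈ extDomain a b) (r : ℝ) :
    ∃ I : Set ℝ, MeasurableSet I ∧ volume I = ENNReal.ofReal r ∧
      (∀ y ∈ I, |x - y| ≤ r) ∧ I ⊆ extInterval a b x r := by
  have hx' : x ≤ a ∨ b ≤ x := by
    by_contra! h
    exact hx h
  rcases hx' with h | h
  · refine ⟨Ioo (x - r) x, measurableSet_Ioo, by simp, ?_, ?_⟩
    · rintro y ⟨h1, h2⟩
      rw [abs_le]; constructor <;> linarith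
    · rintro y ⟨h1, h2⟩
      exact ⟨⟨h1, by linarith⟩, fun h' => by linarith [h'.1]⟩
  · refine ⟨Ioo x (x + r), measurableSet_Ioo, by simp, ?_, ?_⟩
    · rintro y ⟨h1, h2⟩
      rw [abs_le]; constructor <;> linarith
    · rintro y ⟨h1, h2⟩
      exact ⟨⟨by linarith, h2⟩, fun h' => by linarith [h'.2]⟩

theorem extInterval_subset (a b y κ : ℝ) : extInterval a b y κ ⊆ extDomain a b :=
  inter_subset_right

theorem aemeasurable_diffQuot {u : ℝ → ℝ} (hu : AEMeasurable u volume) (D : Set ℝ) :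
    AEMeasurable (fun z : ℝ × ℝ => diffQuot u z.1 z.2)
      ((volume.restrict D).prod (volume.restrict D)) := by
  have hD : AEMeasurable u (volume.restrict D) := hu.mono_measure Measure.restrict_le_self
  have h1 : AEMeasurable (fun z : ℝ × ℝ => u z.1)
      ((volume.restrict D).prod (volume.restrict D)) := hD.comp_fst
  have h2 : AEMeasurable (fun z : ℝ × ℝ => u z.2)
      ((volume.restrict D).prod (volume.restrict D)) := hD.comp_snd
  have h3 : AEMeasurable (fun z : ℝ × ℝ => |z.1 - z.2| ^ 2)
      ((volume.restrict D).prod (volume.restrict D)) := Measurable.aemeasurable (by fun_prop)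
  exact (((h1.sub h2).abs.pow_const 2).div h3).ennreal_ofReal

/-- The square of the exterior domain is only part of the complement of (a,b)²; the factor 2π undoes
the normalization. -/
theorem extSeminorm_le {a b : ℝ} {u : ℝ → ℝ} (hu : AEMeasurable u volume) :
    extSeminorm a b u ≤ ENNReal.ofReal (2 * Real.pi) * extEnergy a b u := by
  have hD := measurableSet_extDomain a b
  have h1 : extSeminorm a b u ≤ ∫⁻ z in (Ioo a b ×ˢ Ioo a b : Set (ℝ × ℝ))ᶜ,
      ENNReal.ofReal (|u z.1 - u z.2| ^ 2 / |z.1 - z.2| ^ 2) := by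
    unfold extSeminorm
    rw [← lintegral_prod _ (aemeasurable_diffQuot hu _), Measure.prod_restrict]
    refine lintegral_mono_set ?_
    rintro z ⟨hz, -⟩ hz'
    exact hz hz'.1
  have hpi := Real.pi_pos
  have h2 : ENNReal.ofReal (2 * Real.pi) * ENNReal.ofReal (1 / (2 * Real.pi)) = 1 := by
    rw [← ENNReal.ofReal_mul (by positivity), ← ENNReal.ofReal_one]
    congr 1; field_simp
  rw [extEnergy, mul_add, ← mul_assoc, h2, one_mul]
  exact h1.trans le_self_add

theorem extPow_two_le (a b : ℝ) (u : ℝ → ℝ) : extPow a b u 2 ≤ extEnergy a b u :=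
  le_add_self

/-! ### Integrated estimates -/

/-- Sobolev-type gain of two powers of integrability. -/
theorem extPow_add_two_le {a b : ℝ} {u : ℝ → ℝ} (hu : AEMeasurable u volume) {s : ℕ} {N : ℝ}
    (hN : 0 < N) (hs : extPow a b u s ≤ ENNReal.ofReal N) :
    extPow a b u (s + 2) ≤ ENNReal.ofReal (2 ^ (s + 4) * N) * extSeminorm a b u := by
  rw [extPow, extSeminorm, ← lintegral_const_mul' _ _ ENNReal.ofReal_ne_top]
  refine setLIntegral_mono' (measurableSet_extDomain a b) fun x hx => ?_
  rcases (abs_nonneg (u x)).eq_or_lt with h0 | h0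
  · simp [← h0]
  obtain ⟨I, hI, hvol, hdist, hsub⟩ := exists_subset_extDomain hx (2 ^ (s + 1) * N / |u x| ^ s)
  have hID := hsub.trans (extInterval_subset _ _ _ _)
  refine (pow_le_lintegral_diffQuot hu h0 hN rfl hI hvol hdist
    ((lintegral_mono_set hID).trans hs)).trans ?_
  gcongr

/-- The fourth power is controlled by the local masses at scale `κ`. -/
theorem extPow_four_le {a b : ℝ} {u : ℝ → ℝ} (hu : AEMeasurable u volume) {κ N : ℝ} (hκ : 0 < κ)
    (hN : 0 < N)
    (hloc : ∀ x ∈ extDomain a b,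
      ∫⁻ y in extInterval a b x κ, ENNReal.ofReal (|u y| ^ 2) ≤ ENNReal.ofReal N) :
    extPow a b u 4 ≤ ENNReal.ofReal (64 * N) * extSeminorm a b u +
      ENNReal.ofReal (8 * N / κ) * extPow a b u 2 := by
  have hD : AEMeasurable u (volume.restrict (extDomain a b)) :=
    hu.mono_measure Measure.restrict_le_self
  rw [extPow, extSeminorm, extPow, ← lintegral_const_mul' _ _ ENNReal.ofReal_ne_top,
    ← lintegral_const_mul' _ _ ENNReal.ofReal_ne_top, ← lintegral_add_right' _ (by fun_prop)]
  refine setLIntegral_mono' (measurableSet_extDomain a b) fun x hx => ?_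
  rcases (abs_nonneg (u x)).eq_or_lt with h0 | h0
  · simp [← h0]
  -- Either the interval fits in the window of radius κ, or |u x|² is at most 8N/κ.
  by_cases hr : 2 ^ (2 + 1) * N / |u x| ^ 2 ≤ κ
  · obtain ⟨I, hI, hvol, hdist, hsub⟩ := exists_subset_extDomain hx (2 ^ (2 + 1) * N / |u x| ^ 2)
    have hIκ : I ⊆ extInterval a b x κ := hsub.trans
      (inter_subset_inter_left _ (Ioo_subset_Ioo (by linarith) (by linarith)))
    refine le_add_right ((pow_le_lintegral_diffQuot hu h0 hN rfl hI hvol hdist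
      ((lintegral_mono_set hIκ).trans (hloc x hx))).trans ?_)
    norm_num
    gcongr
    exact hIκ.trans (extInterval_subset _ _ _ _)
  · refine le_add_left ?_
    rw [← ENNReal.ofReal_mul (by positivity)]
    refine ENNReal.ofReal_le_ofReal ?_
    rw [not_le, lt_div_iff₀ (by positivity)] at hr
    have h1 : |u x| ^ 2 ≤ 8 * N / κ := by
      rw [le_div_iff₀ hκ]; norm_num at hr ⊢; linarith
    calc |u x| ^ 4 = |u x| ^ 2 * |u x| ^ 2 := by ring
      _ ≤ _ := by gcongr

theorem extPow_even_lt_top {a b : ℝ} {u : ℝ → ℝ} (hu : u ∈ HHalfExt a b) (k : ℕ) :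
    extPow a b u (2 * k + 2) < ∞ := by
  induction k with
  | zero => exact (extPow_two_le a b u).trans_lt hu.2
  | succ k ih =>
    -- The added 1 keeps N positive.
    have hle : extPow a b u (2 * k + 2) ≤
        ENNReal.ofReal ((extPow a b u (2 * k + 2)).toReal + 1) := by
      rw [ENNReal.le_ofReal_iff_toReal_le ih.ne (by positivity)]; linarith
    refine (extPow_add_two_le hu.1 (by positivity) hle).trans_lt
      (ENNReal.mul_lt_top ENNReal.ofReal_lt_top ?_)
    exact (extSeminorm_le hu.1).trans_lt (ENNReal.mul_lt_top ENNReal.ofReal_lt_top hu.2)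

/-! ### Interpolation -/

/-- Interpolation of a power between the square and a higher power. -/
theorem rpow_le_sq_add_pow {t p δ : ℝ} (ht : 0 ≤ t) (hp : 2 < p) (hδ : 0 < δ) {m : ℕ}
    (hm : p ≤ m) : t ^ p ≤ δ ^ (p - 2) * t ^ 2 + δ ^ (p - m) * t ^ m := by
  rcases ht.eq_or_lt with rfl | ht0
  · rw [Real.zero_rpow (by linarith)]; positivity
  rcases le_total t δ with h | h
  · have h1 : t ^ p = t ^ (p - 2) * t ^ 2 := by
      rw [← Real.rpow_natCast, ← Real.rpow_add ht0]; norm_num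
    have h2 : t ^ (p - 2) ≤ δ ^ (p - 2) := Real.rpow_le_rpow ht h (by linarith)
    have h3 : 0 ≤ δ ^ (p - m) * t ^ m := by positivity
    rw [h1]; nlinarith [sq_nonneg t]
  · have h1 : t ^ p = t ^ (p - m) * t ^ m := by
      rw [← Real.rpow_natCast, ← Real.rpow_add ht0]; norm_num
    have h2 : t ^ (p - m) ≤ δ ^ (p - m) := Real.rpow_le_rpow_of_nonpos hδ h (by linarith)
    have h3 : 0 ≤ δ ^ (p - 2) * t ^ 2 := by positivity
    have h4 : t ^ (p - m) * t ^ m ≤ δ ^ (p - m) * t ^ m := by gcongr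
    rw [h1]; linarith

theorem lintegral_rpow_le {a b : ℝ} {u : ℝ → ℝ} (hu : AEMeasurable u volume) {p δ : ℝ}
    (hp : 2 < p) (hδ : 0 < δ) {m : ℕ} (hm : p ≤ m) :
    ∫⁻ x in extDomain a b, ENNReal.ofReal (|u x| ^ p) ≤
      ENNReal.ofReal (δ ^ (p - 2)) * extPow a b u 2 +
        ENNReal.ofReal (δ ^ (p - m)) * extPow a b u m := by
  have hD : AEMeasurable u (volume.restrict (extDomain a b)) :=
    hu.mono_measure Measure.restrict_le_self
  rw [extPow, extPow, ← lintegral_const_mul' _ _ ENNReal.ofReal_ne_top,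
    ← lintegral_const_mul' _ _ ENNReal.ofReal_ne_top, ← lintegral_add_right' _ (by fun_prop)]
  refine lintegral_mono fun x => ?_
  rw [← ENNReal.ofReal_mul (by positivity), ← ENNReal.ofReal_mul (by positivity),
    ← ENNReal.ofReal_add (by positivity) (by positivity)]
  exact ENNReal.ofReal_le_ofReal (rpow_le_sq_add_pow (abs_nonneg _) hp hδ hm)

/-! ### Passage to the limit -/

theorem tendsto_extPow_four {a b κ : ℝ} (hκ : 0 < κ) {u : ℕ → ℝ → ℝ}
    (hu : ∀ n, AEMeasurable (u n) volume) {E : ℝ≥0∞} (hE : E ≠ ∞)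
    (hbdd : ∀ n, extEnergy a b (u n) ≤ E)
    (hvanish : Tendsto
      (fun n => ⨆ (y : ℝ) (_ : (extInterval a b y κ).Nonempty),
        ∫⁻ x in extInterval a b y κ, ENNReal.ofReal (|u n x| ^ 2))
      atTop (𝓝 0)) :
    Tendsto (fun n => extPow a b (u n) 4) atTop (𝓝 0) := by
  set c : ℝ → ℝ≥0∞ := fun ε => ENNReal.ofReal (64 * ε) * (ENNReal.ofReal (2 * Real.pi) * E) +
    ENNReal.ofReal (8 * ε / κ) * E with hc
  have hE' : ENNReal.ofReal (2 * Real.pi) * E ≠ ∞ := ENNReal.mul_ne_top ENNReal.ofReal_ne_top hE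
  have hc0 : Tendsto c (𝓝[>] 0) (𝓝 0) := by
    have h1 : Tendsto (fun ε : ℝ => ENNReal.ofReal (64 * ε)) (𝓝 0) (𝓝 0) := by
      have : Continuous fun ε : ℝ => ENNReal.ofReal (64 * ε) :=
          ENNReal.continuous_ofReal.comp (by fun_prop)
      simpa using this.tendsto 0
    have h2 : Tendsto (fun ε : ℝ => ENNReal.ofReal (8 * ε / κ)) (𝓝 0) (𝓝 0) := by
      have : Continuous fun ε : ℝ => ENNReal.ofReal (8 * ε / κ) :=
          ENNReal.continuous_ofReal.comp (by fun_prop)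
      simpa using this.tendsto 0
    have h3 := (ENNReal.Tendsto.mul_const h1 (Or.inr hE')).add
      (ENNReal.Tendsto.mul_const h2 (Or.inr hE))
    simp only [zero_mul, add_zero] at h3
    exact h3.mono_left nhdsWithin_le_nhds
  rw [ENNReal.tendsto_nhds_zero]
  intro η hη
  obtain ⟨ε, hεη, hε⟩ := ((ENNReal.tendsto_nhds_zero.1 hc0 η hη).and self_mem_nhdsWithin).exists
  have hε : 0 < ε := hε
  filter_upwards [ENNReal.tendsto_nhds_zero.1 hvanish (ENNReal.ofReal ε) (by simpa using hε)]
    with n hn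
  refine (extPow_four_le (hu n) hκ hε fun x hx => ?_).trans (le_trans ?_ hεη)
  · refine le_trans ?_ hn
    -- The window is nonempty because it contains its centre x.
    exact le_iSup₂_of_le x ⟨x, ⟨by linarith, by linarith⟩, hx⟩ le_rfl
  · have h1 := (extSeminorm_le (a := a) (b := b) (hu n)).trans (mul_le_mul_right (hbdd n) _)
    have h2 := (extPow_two_le a b (u n)).trans (hbdd n)
    simp only [hc]
    gcongr

/-- The bound for the next even power is a small N times a seminorm bounded in n. -/
theorem tendsto_extPow_even {a b : ℝ} {u : ℕ → ℝ → ℝ}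
    (hu : ∀ n, AEMeasurable (u n) volume) {E : ℝ≥0∞} (hE : E ≠ ∞)
    (hbdd : ∀ n, extEnergy a b (u n) ≤ E)
    (h4 : Tendsto (fun n => extPow a b (u n) 4) atTop (𝓝 0)) (k : ℕ) :
    Tendsto (fun n => extPow a b (u n) (2 * k + 4)) atTop (𝓝 0) := by
  induction k with
  | zero => exact h4
  | succ k ih =>
    have hE' : ENNReal.ofReal (2 * Real.pi) * E ≠ ∞ :=
      ENNReal.mul_ne_top ENNReal.ofReal_ne_top hE
    have hc0 : Tendsto (fun ε : ℝ => ENNReal.ofReal (2 ^ (2 * k + 4 + 4) * ε) *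
        (ENNReal.ofReal (2 * Real.pi) * E)) (𝓝[>] 0) (𝓝 0) := by
      have h1 : Tendsto (fun ε : ℝ => ENNReal.ofReal (2 ^ (2 * k + 4 + 4) * ε)) (𝓝 0) (𝓝 0) := by
        have : Continuous fun ε : ℝ => ENNReal.ofReal (2 ^ (2 * k + 4 + 4) * ε) :=
          ENNReal.continuous_ofReal.comp (by fun_prop)
        simpa using this.tendsto 0
      have h3 := ENNReal.Tendsto.mul_const h1 (Or.inr hE')
      rw [zero_mul] at h3
      exact h3.mono_left nhdsWithin_le_nhds
    rw [ENNReal.tendsto_nhds_zero]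
    intro η hη
    obtain ⟨ε, hεη, hε⟩ := ((ENNReal.tendsto_nhds_zero.1 hc0 η hη).and self_mem_nhdsWithin).exists
    have hε : 0 < ε := hε
    filter_upwards [ENNReal.tendsto_nhds_zero.1 ih (ENNReal.ofReal ε) (by simpa using hε)]
      with n hn
    refine (extPow_add_two_le (hu n) hε hn).trans (le_trans ?_ hεη)
    have h1 := (extSeminorm_le (a := a) (b := b) (hu n)).trans (mul_le_mul_right (hbdd n) _)
    gcongr

theorem tendsto_lintegral_rpow {a b : ℝ} {u : ℕ → ℝ → ℝ}
    (hu : ∀ n, AEMeasurable (u n) volume) {E : ℝ≥0∞} (hE : E ≠ ∞)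
    (hbdd : ∀ n, extEnergy a b (u n) ≤ E) {p : ℝ} (hp : 2 < p) {m : ℕ} (hm : p ≤ m)
    (hpow : Tendsto (fun n => extPow a b (u n) m) atTop (𝓝 0)) :
    Tendsto (fun n => ∫⁻ x in extDomain a b, ENNReal.ofReal (|u n x| ^ p)) atTop (𝓝 0) := by
  have hc0 : Tendsto (fun δ : ℝ => ENNReal.ofReal (δ ^ (p - 2)) * E) (𝓝[>] 0) (𝓝 0) := by
    have h1 : Tendsto (fun δ : ℝ => ENNReal.ofReal (δ ^ (p - 2))) (𝓝 0) (𝓝 0) := by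
      have : Continuous fun δ : ℝ => ENNReal.ofReal (δ ^ (p - 2)) :=
        ENNReal.continuous_ofReal.comp (Real.continuous_rpow_const (by linarith))
      simpa [Real.zero_rpow (by linarith : p - 2 ≠ 0)] using this.tendsto 0
    have h3 := ENNReal.Tendsto.mul_const h1 (Or.inr hE)
    rw [zero_mul] at h3
    exact h3.mono_left nhdsWithin_le_nhds
  rw [ENNReal.tendsto_nhds_zero]
  intro η hη
  have hη2 : 0 < η / 2 := ENNReal.half_pos hη.ne'
  -- δ is fixed before n: it makes the L² term small uniformly in n, whatever the size of δ^(p-m).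
  obtain ⟨δ, hδη, hδ⟩ :=
    ((ENNReal.tendsto_nhds_zero.1 hc0 (η / 2) hη2).and self_mem_nhdsWithin).exists
  have hδ : 0 < δ := hδ
  have hpow' : Tendsto (fun n => ENNReal.ofReal (δ ^ (p - m)) * extPow a b (u n) m)
      atTop (𝓝 0) := by
    simpa using ENNReal.Tendsto.const_mul hpow (Or.inr ENNReal.ofReal_ne_top)
  filter_upwards [ENNReal.tendsto_nhds_zero.1 hpow' (η / 2) hη2] with n hn
  refine (lintegral_rpow_le (hu n) hp hδ hm).trans ?_
  rw [← ENNReal.add_halves η]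
  refine add_le_add (le_trans ?_ hδη) hn
  have := (extPow_two_le a b (u n)).trans (hbdd n)
  gcongr

theorem proposition3p1 (a b : ℝ) (hab : a < b) (κ : ℝ) (hκ : 0 < κ) (u : ℕ → ℝ → ℝ)
    (hu : ∀ n, u n ∈ HHalfExt a b)
    (hbdd : ∃ M : ℝ, ∀ n, hHalfExtNorm a b (u n) ≤ M)
    (hvanish : Tendsto
      (fun n => ⨆ (y : ℝ) (_ : (extInterval a b y κ).Nonempty),
        ∫⁻ x in extInterval a b y κ, ENNReal.ofReal (|u n x| ^ 2))
      atTop (𝓝 0)) :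
    ∀ p : ℝ, 2 < p →
      (∀ n, MemLp (u n) (ENNReal.ofReal p) (volume.restrict (extDomain a b))) ∧
      Tendsto (fun n => ∫ x in extDomain a b, |u n x| ^ p) atTop (𝓝 0) := by
  intro p hp
  have hp0 : 0 < p := by linarith
  obtain ⟨M, hM⟩ := hbdd
  have hE : ∀ n, extEnergy a b (u n) ≤ ENNReal.ofReal (M ^ 2) := fun n => by
    rw [ENNReal.le_ofReal_iff_toReal_le (hu n).2.ne (by positivity)]
    exact (Real.sqrt_le_iff.1 (hM n)).2
  obtain ⟨k, hk⟩ := exists_nat_ge p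
  have hm : p ≤ ((2 * k + 4 : ℕ) : ℝ) := by push_cast; linarith
  have hD : ∀ n, AEMeasurable (u n) (volume.restrict (extDomain a b)) := fun n =>
    (hu n).1.mono_measure Measure.restrict_le_self
  refine ⟨fun n => ?_, ?_⟩
  · have hfin : ∫⁻ x in extDomain a b, ENNReal.ofReal (|u n x| ^ p) < ∞ := by
      refine (lintegral_rpow_le (hu n).1 hp one_pos hm).trans_lt (ENNReal.add_lt_top.2 ⟨?_, ?_⟩)
      · exact ENNReal.mul_lt_top ENNReal.ofReal_lt_top (extPow_even_lt_top (hu n) 0)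
      · exact ENNReal.mul_lt_top ENNReal.ofReal_lt_top (extPow_even_lt_top (hu n) (k + 1))
    refine ⟨(hD n).aestronglyMeasurable, ?_⟩
    rw [eLpNorm_lt_top_iff_lintegral_rpow_enorm_lt_top (by simpa using hp0)
      ENNReal.ofReal_ne_top, ENNReal.toReal_ofReal hp0.le]
    convert hfin using 3 with x
    rw [Real.enorm_eq_ofReal_abs, ENNReal.ofReal_rpow_of_nonneg (abs_nonneg _) hp0.le]
  · have hlim := tendsto_lintegral_rpow (fun n => (hu n).1) ENNReal.ofReal_ne_top hE hp hm
      (tendsto_extPow_even (fun n => (hu n).1) ENNReal.ofReal_ne_top hE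
        (tendsto_extPow_four hκ (fun n => (hu n).1) ENNReal.ofReal_ne_top hE hvanish) k)
    have h := (ENNReal.tendsto_toReal ENNReal.zero_ne_top).comp hlim
    rw [ENNReal.toReal_zero] at h
    refine h.congr fun n => ?_
    rw [integral_eq_lintegral_of_nonneg_ae (ae_of_all _ fun x => by positivity)]
    · rfl
    · have := hD n
      exact AEMeasurable.aestronglyMeasurable (by fun_prop)
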